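/- **Theorem (impossibility of multi-key statistical PRS from one copy of the common Haar state).** Let $n,\ell:\mathbb N\to\mathbb N$ satisfy $\ell(\lambda)=\Omega(\lambda/\log\lambda)$ and $n(\lambda)=\omega(\log\lambda)$ as $\lambda\to\infty$. Write $n=n(\lambda)$, $\ell=\ell(\lambda)$, and let $\mathcal H_n$ be the Haar probability measure on pure $n$-qubit states. Consider a generator $G$ that uses a single copy of the $n$-qubit common Haar state and outputs $n$ qubits: for every $\lambda\in\mathbb N$ and $k\in\{0,1\}^\lambda$, a quantum channel $G_k$ from $n$ qubits to $n$ qubits (no efficiency is required of $G$, so quantum polynomial-time generators are covered). Call $G$ a *multi-key $\ell$-copy statistical PRS generator in the common Haar state (CHS) model* if 1. (State generation) for all $\lambda$, all $k\in\{0,1\}^\lambda$ and every pure $n$-qubit state $|\vartheta\rangle$, there is a pure $n$-qubit state $|\vartheta_k\rangle$ with $G_k(|\vartheta\rangle\langle\vartheta|)=|\vartheta_k\rangle\langle\vartheta_k|$; and 2. (Multi-key pseudorandomness) for all polynomials $t,p$ with natural-number coefficients and every computationally unbounded adversary $A=(A_\lambda)_\lambda$ with one-bit output (each $A_\lambda$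 an arbitrary two-outcome quantum measurement), there is a negligible function $\operatorname{negl}$ such that for all $\lambda$, with $t=t(\lambda)$ and $p=p(\lambda)$, $$\left|\Pr_{\substack{k_1,\dots,k_p\leftarrow\{0,1\}^\lambda\\ |\vartheta\rangle\leftarrow\mathcal H_n}}\Big[A_\lambda\Big(\bigotimes_{i=1}^p G_{k_i}(|\vartheta\rangle\langle\vartheta|)^{\otimes \ell}\otimes|\vartheta\rangle\langle\vartheta|^{\otimes t}\Big)=1\Big]-\Pr_{\substack{|\varphi_1\rangle,\dots,|\varphi_p\rangle\leftarrow\mathcal H_n\\ |\vartheta\rangle\leftarrow\mathcal H_n}}\Big[A_\lambda\Big(\bigotimes_{i=1}^p|\varphi_i\rangle\langle\varphi_i|^{\otimes \ell}\otimes|\vartheta\rangle\langle\vartheta|^{\otimes t}\Big)=1\Big]\right|\le\operatorname{negl}(\lambda),$$ where the keys are independent and uniform and the Haar states are independent. Then no multi-key $\ell$-copy statistical PRS generator of this kind exists in the CHS model. -/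

import Mathlib

open scoped ComplexOrder

namespace CHS

/-- Labels of the computational basis of `n` qubits: bit strings of length `n`. -/
abbrev Basis (n : ℕ) : Type := Fin n → Bool

/-- The state space `(ℂ²)^{⊗ n} = ℂ^{{0,1}ⁿ}` of `n` qubits. -/
abbrev QubitSpace (n : ℕ) : Type := EuclideanSpace ℂ (Basis n)

/-- Pure `n`-qubit states: unit vectors. -/
abbrev PureState (n : ℕ) : Type := Metric.sphere (0 : QubitSpace n) 1

/-- The Haar measure on `n`-qubit pure states: the surface measure of the unit sphere of `ℂ^{2ⁿ}`,
normalised to total mass one. -/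
noncomputable def haarState (n : ℕ) : MeasureTheory.Measure (PureState n) :=
  ((MeasureTheory.volume : MeasureTheory.Measure (QubitSpace n)).toSphere Set.univ)⁻¹ •
    (MeasureTheory.volume : MeasureTheory.Measure (QubitSpace n)).toSphere

instance haarState_isProbabilityMeasure (n : ℕ) :
    MeasureTheory.IsProbabilityMeasure (haarState n) := by
  constructor
  have h0 : (MeasureTheory.volume : MeasureTheory.Measure (QubitSpace n)).toSphere Set.univ ≠ 0 := by
    rw [Ne, MeasureTheory.Measure.measure_univ_eq_zero]
    exact MeasureTheory.Measure.toSphere_ne_zero _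
  rw [haarState, MeasureTheory.Measure.smul_apply, smul_eq_mul]
  exact ENNReal.inv_mul_cancel h0 (MeasureTheory.measure_ne_top _ _)

/-- The density matrix `|ψ⟩⟨ψ|`. -/
def ketbra {n : ℕ} (ψ : PureState n) : Matrix (Basis n) (Basis n) ℂ :=
  Matrix.of fun x y => ψ.1 x * star (ψ.1 y)

/-- The tensor product `⨂ i, ρ i` of matrices indexed by a finite set `ι` of registers,
as a matrix on the product basis. -/
def tensor {ι B : Type} [Fintype ι] (ρ : ι → Matrix B B ℂ) : Matrix (ι → B) (ι → B) ℂ :=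
  Matrix.of fun x y => ∏ i, ρ i (x i) (y i)

/-- The map `id_r ⊗ Φ` on `ℂ^{r × r} ⊗ ℂ^{B × B}`: apply `Φ` to each of the `r × r` blocks. -/
def ampliation {B C : Type} (r : ℕ) (Φ : Matrix B B ℂ →ₗ[ℂ] Matrix C C ℂ)
    (M : Matrix (Fin r × B) (Fin r × B) ℂ) : Matrix (Fin r × C) (Fin r × C) ℂ :=
  Matrix.of fun x y => Φ (Matrix.of fun a b => M (x.1, a) (y.1, b)) x.2 y.2

/-- Quantum channels from operators on `n` qubits to operators on `m` qubits:
completely positive trace-preserving linear maps. -/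
structure QuantumChannel (n m : ℕ) where
  toLinearMap : Matrix (Basis n) (Basis n) ℂ →ₗ[ℂ] Matrix (Basis m) (Basis m) ℂ
  completelyPositive : ∀ (r : ℕ) (M : Matrix (Fin r × Basis n) (Fin r × Basis n) ℂ),
    M.PosSemidef → (ampliation r toLinearMap M).PosSemidef
  tracePreserving : ∀ M : Matrix (Basis n) (Basis n) ℂ, (toLinearMap M).trace = M.trace

/-- Generators that use one copy of an `n(lam)`-qubit common Haar state and output `n(lam)` qubits:
for every security parameter `lam` and key `k ∈ {0,1}^lam`, a quantum channel `G_k`.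
No bound on the complexity of the generator is imposed. -/
abbrev OneCopyGenerator (n : ℕ → ℕ) : Type :=
  (lam : ℕ) → (Fin lam → Bool) → QuantumChannel (n lam) (n lam)

/-- State generation: every `G_k` maps every pure state to a pure state. -/
def StateGeneration {n : ℕ → ℕ} (G : OneCopyGenerator n) : Prop :=
  ∀ (lam : ℕ) (k : Fin lam → Bool) (ϑ : PureState (n lam)),
    ∃ ϑk : PureState (n lam), (G lam k).toLinearMap (ketbra ϑ) = ketbra ϑk

/-- The registers handed to the adversary: `ℓ` registers for each of `p` keys, and `t` registers
for copies of the common Haar state. -/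
abbrev Registers (p ℓ t : ℕ) : Type := (Fin p × Fin ℓ) ⊕ Fin t

/-- A computationally unbounded one-bit-output adversary on a system with basis `B`, given by its
measurement operator `E` for the outcome `1`, where `0 ≤ E ≤ 1`. -/
structure Adversary (B : Type) [Fintype B] [DecidableEq B] where
  effect : Matrix B B ℂ
  effect_nonneg : effect.PosSemidef
  effect_le_one : (1 - effect).PosSemidef

/-- The probability `Tr(E ρ)` that the adversary outputs `1` on the state `ρ`. -/
noncomputable def Adversary.acceptProb {B : Type} [Fintype B] [DecidableEq B]
    (A : Adversary B) (ρ : Matrix B B ℂ) : ℝ :=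
  (A.effect * ρ).trace.re

/-- The joint state `⨂_{i ≤ p} (σ i)^{⊗ ℓ} ⊗ τ^{⊗ t}`. -/
def jointState {B : Type} {p : ℕ} (ℓ t : ℕ) (σ : Fin p → Matrix B B ℂ) (τ : Matrix B B ℂ) :
    Matrix (Registers p ℓ t → B) (Registers p ℓ t → B) ℂ :=
  tensor (Sum.elim (fun r : Fin p × Fin ℓ => σ r.1) (fun _ : Fin t => τ))

/-- The probability that the adversary outputs `1` on
`⨂_i G_{k_i}(ϑ)^{⊗ ℓ} ⊗ |ϑ⟩⟨ϑ|^{⊗ t}`, for independent uniform keys `k_1, …, k_p` and a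
Haar random `ϑ`. -/
noncomputable def realProb {n : ℕ → ℕ} (G : OneCopyGenerator n) (lam p ℓ t : ℕ)
    (A : Adversary (Registers p ℓ t → Basis (n lam))) : ℝ :=
  (∑ k : Fin p → Fin lam → Bool, ∫ ϑ : PureState (n lam),
      A.acceptProb (jointState ℓ t (fun i => (G lam (k i)).toLinearMap (ketbra ϑ)) (ketbra ϑ))
        ∂(haarState (n lam))) /
    (Fintype.card (Fin p → Fin lam → Bool) : ℝ)

/-- The probability that the adversary outputs `1` on
`⨂_i |φ_i⟩⟨φ_i|^{⊗ ℓ} ⊗ |ϑ⟩⟨ϑ|^{⊗ t}`, for independent Haar random `φ_1, …, φ_p, ϑ`. -/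
noncomputable def idealProb (m p ℓ t : ℕ) (A : Adversary (Registers p ℓ t → Basis m)) : ℝ :=
  ∫ s : (Fin p → PureState m) × PureState m,
    A.acceptProb (jointState ℓ t (fun i => ketbra (s.1 i)) (ketbra s.2))
      ∂((MeasureTheory.Measure.pi fun _ : Fin p => haarState m).prod (haarState m))

/-- Negligible functions of the security parameter. -/
def Negligible (f : ℕ → ℝ) : Prop :=
  Asymptotics.SuperpolynomialDecay Filter.atTop (fun lam : ℕ => (lam : ℝ)) f

/-- Multi-key pseudorandomness against computationally unbounded adversaries. -/
def MultiKeyPseudorandom {n : ℕ → ℕ} (ℓ : ℕ → ℕ) (G : OneCopyGenerator n) : Prop :=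
  ∀ (t p : Polynomial ℕ)
    (A : (lam : ℕ) →
      Adversary (Registers (p.eval lam) (ℓ lam) (t.eval lam) → Basis (n lam))),
    ∃ negl : ℕ → ℝ, Negligible negl ∧ ∀ lam : ℕ,
      |realProb G lam (p.eval lam) (ℓ lam) (t.eval lam) (A lam) -
        idealProb (n lam) (p.eval lam) (ℓ lam) (t.eval lam) (A lam)| ≤ negl lam

/-- Multi-key `ℓ`-copy statistical pseudorandom state generators in the common Haar state model,
for generators using one copy of the common Haar state. -/
structure IsMultiKeyStatisticalPRS {n : ℕ → ℕ} (ℓ : ℕ → ℕ) (G : OneCopyGenerator n) : Prop where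
  stateGeneration : StateGeneration G
  pseudorandom : MultiKeyPseudorandom ℓ G

end CHS

/-! The distinguisher needs no copy of the common state (`t = 0`). A channel sending pure states to
pure states acts, on almost every `ϑ`, as `ϑ ↦ Kϑ` up to a scalar, with one fixed Kraus operator `K`
(`QuantumChannel.exists_operator_of_pure`). For a fixed key tuple the joint output is therefore a
linear image of `ϑ^{⊗ pℓ}`, which lives in a symmetric subspace. With `d = 2 ^ n`, all real outputs
together lie, almost surely, in a space `W` of dimension at most `2^{λp} · d.multichoose (pℓ)`
(`exists_submodule_prod_mulVec`), and projecting onto `W` accepts them with probability 1.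

The ideal state is spread over `p` symmetric subspaces: its nonzero eigenvalues all equal
`(d.multichoose ℓ)⁻¹ ^ p` (`haarMoment_mul_self`). Hence it is accepted with probability at most
`dim W` times this number (`idealProb_zero_le`). For `p` a large power of `λ` the product is at most
1/2 (`exists_eventually_key_count_mul_ratio_le`): the `p` keys carry only `λp` bits, while the
dimension ratio is at most `(6/p)^{mp}` for some `m` of order `λ / log λ`. -/

namespace CHS

open MeasureTheory

/-! ### Unitary invariance and null sets of the Haar measure. -/

/-- The action of a linear isometry of the state space on pure states. -/
noncomputable def mapState {n : ℕ} (U : QubitSpace n ≃ₗᵢ[ℂ] QubitSpace n) (ψ : PureState n) :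
    PureState n :=
  ⟨U ψ.1, by simp⟩

theorem continuous_mapState {n : ℕ} (U : QubitSpace n ≃ₗᵢ[ℂ] QubitSpace n) :
    Continuous (mapState U) :=
  (U.continuous.comp continuous_subtype_val).subtype_mk _

-- The surface measure of `s` is a multiple of the volume of the cone `(0,1) • s`. A unitary carries
-- cones to cones and, as a real isometry, preserves volume.
open scoped Pointwise in
theorem measurePreserving_mapState {n : ℕ} (U : QubitSpace n ≃ₗᵢ[ℂ] QubitSpace n) :
    MeasurePreserving (mapState U) (haarState n) (haarState n) := by
  have key : MeasurePreserving (mapState U) (volume : Measure (QubitSpace n)).toSphere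
      (volume : Measure (QubitSpace n)).toSphere := by
    refine ⟨(continuous_mapState U).measurable, ?_⟩
    ext s hs
    rw [Measure.map_apply (continuous_mapState U).measurable hs,
      Measure.toSphere_apply' _ hs,
      Measure.toSphere_apply' _ ((continuous_mapState U).measurable hs)]
    congr 1
    let V : QubitSpace n ≃ₗᵢ[ℝ] QubitSpace n :=
      { U.toLinearEquiv.restrictScalars ℝ with norm_map' := U.norm_map }
    have hV : MeasurePreserving V.toMeasurableEquiv volume volume := V.measurePreserving
    rw [← hV.measure_preimage_equiv (Set.Ioo (0 : ℝ) 1 • (Subtype.val '' s))]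
    congr 1
    ext z
    simp only [Set.mem_smul, Set.mem_image, Set.mem_preimage, Subtype.exists]
    constructor
    · rintro ⟨r, hr, y, ⟨w, hw, hw', rfl⟩, rfl⟩
      exact ⟨r, hr, U w, ⟨U w, (mapState U ⟨w, hw⟩).2, hw', rfl⟩, (V.map_smul r w).symm⟩
    · rintro ⟨r, hr, y, ⟨w, hw, hw', rfl⟩, h⟩
      refine ⟨r, hr, U.symm w, ⟨U.symm w, by simpa using hw, ?_, rfl⟩, ?_⟩
      · change mapState U ⟨U.symm w, _⟩ ∈ s
        simpa [mapState] using hw'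
      · apply V.injective
        rw [V.map_smul]
        change r • U (U.symm w) = _
        rw [U.apply_symm_apply]
        exact h
  exact ⟨key.measurable, by rw [haarState, Measure.map_smul, key.map_eq]⟩

/-- Continuous functions on the set of pure states are integrable. -/
theorem integrable_of_continuous {n : ℕ} {E : Type*} [NormedAddCommGroup E]
    [SecondCountableTopologyEither (PureState n) E] {f : PureState n → E} (hf : Continuous f) :
    Integrable f (haarState n) := by
  have : CompactSpace (PureState n) := isCompact_iff_compactSpace.mp (isCompact_sphere _ _)
  exact hf.integrable_of_hasCompactSupport (HasCompactSupport.of_compactSpace f)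

/-- Almost every pure state lies outside a given proper subspace. -/
theorem ae_notMem_submodule {n : ℕ} (W : Submodule ℂ (QubitSpace n)) (hW : W ≠ ⊤) :
    ∀ᵐ ψ ∂haarState n, ψ.1 ∉ W := by
  have h0 : (volume : Measure (QubitSpace n)) (W : Set (QubitSpace n)) = 0 := by
    refine Measure.addHaar_submodule volume (W.restrictScalars ℝ) ?_
    simpa using hW
  have hm : MeasurableSet {ψ : PureState n | ψ.1 ∈ W} :=
    (W.closed_of_finiteDimensional.preimage continuous_subtype_val).measurableSet
  rw [ae_iff]
  simp only [not_not]
  -- The cone over the unit vectors of `W` stays inside `W`, which has volume zero.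
  rw [haarState, Measure.smul_apply, Measure.toSphere_apply' _ hm, measure_mono_null _ h0]
  · simp
  · rintro z ⟨r, hr, y, ⟨w, hw, rfl⟩, rfl⟩
    exact (W.restrictScalars ℝ).smul_mem r hw

end CHS

/-! ### Moments of one coordinate, from Gaussian integrals. -/

namespace CHS

open MeasureTheory

theorem finrank_real_qubitSpace (n : ℕ) : Module.finrank ℝ (QubitSpace n) = 2 * 2 ^ n := by
  rw [finrank_real_of_complex]
  simp

/-- Gaussian moments of one coordinate in polar coordinates. -/
theorem integral_gaussian_polar {n : ℕ} (b : Basis n) (ℓ : ℕ) :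
    ∫ z : QubitSpace n, ‖z b‖ ^ (2 * ℓ) * Real.exp (-‖z‖ ^ 2) =
      (∫ ψ : PureState n, ‖ψ.1 b‖ ^ (2 * ℓ)
        ∂(volume : Measure (QubitSpace n)).toSphere) * (Real.Gamma (ℓ + 2 ^ n) / 2) := by
  set μ : Measure (QubitSpace n) := volume
  have hd : Module.finrank ℝ (QubitSpace n) - 1 = 2 * 2 ^ n - 1 := by
    rw [finrank_real_qubitSpace]
  have hpos : 1 ≤ 2 * 2 ^ n := by have := Nat.one_le_two_pow (n := n); omega
  -- The sphere has real dimension `2 * 2 ^ n - 1`, which is the power of `r` in the radial density.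
  have radial : ∫ r : Set.Ioi (0 : ℝ), r.1 ^ (2 * ℓ) * Real.exp (-r.1 ^ 2)
      ∂Measure.volumeIoiPow (2 * 2 ^ n - 1) = Real.Gamma (ℓ + 2 ^ n) / 2 := by
    simp only [Measure.volumeIoiPow, ENNReal.ofReal]
    rw [integral_withDensity_eq_integral_smul,
      integral_subtype_comap measurableSet_Ioi fun a : ℝ ↦
        Real.toNNReal (a ^ (2 * 2 ^ n - 1)) • (a ^ (2 * ℓ) * Real.exp (-a ^ 2))]
    · have h := integral_rpow_mul_exp_neg_rpow (p := 2) (q := (2 * ℓ + (2 * 2 ^ n - 1) : ℕ))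
        two_pos (by
          have : (0 : ℝ) ≤ (2 * ℓ + (2 * 2 ^ n - 1) : ℕ) := Nat.cast_nonneg _
          linarith)
      have hq : (((2 * ℓ + (2 * 2 ^ n - 1) : ℕ) : ℝ) + 1) / 2 = ℓ + 2 ^ n := by
        rw [Nat.cast_add, Nat.cast_sub hpos]
        push_cast
        ring
      rw [hq] at h
      rw [div_eq_mul_one_div, mul_comm (Real.Gamma _), ← h]
      refine setIntegral_congr_fun measurableSet_Ioi fun x hx ↦ ?_
      simp only [NNReal.smul_def, smul_eq_mul]
      rw [Real.coe_toNNReal _ (pow_nonneg (le_of_lt hx) _), Real.rpow_natCast, ← mul_assoc,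
        ← pow_add, add_comm (2 * 2 ^ n - 1)]
      norm_num
    · exact (measurable_subtype_coe.pow_const _).real_toNNReal
  calc ∫ z, ‖z b‖ ^ (2 * ℓ) * Real.exp (-‖z‖ ^ 2) ∂μ
      = ∫ z : ({(0)}ᶜ : Set (QubitSpace n)), ‖z.1 b‖ ^ (2 * ℓ) * Real.exp (-‖z.1‖ ^ 2)
          ∂(μ.comap (↑)) := by
        rw [integral_subtype_comap (measurableSet_singleton _).compl
          fun z : QubitSpace n ↦ ‖z b‖ ^ (2 * ℓ) * Real.exp (-‖z‖ ^ 2), restrict_compl_singleton]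
    _ = ∫ x : PureState n × Set.Ioi (0 : ℝ), ‖x.1.1 b‖ ^ (2 * ℓ) *
          (x.2.1 ^ (2 * ℓ) * Real.exp (-x.2.1 ^ 2))
          ∂μ.toSphere.prod (.volumeIoiPow (Module.finrank ℝ (QubitSpace n) - 1)) := by
        rw [← μ.measurePreserving_homeomorphUnitSphereProd.integral_comp
          (Homeomorph.measurableEmbedding _)]
        refine integral_congr_ae (.of_forall fun z ↦ ?_)
        have hz : ‖z.1‖ ≠ 0 := norm_ne_zero_iff.mpr z.2
        simp only [homeomorphUnitSphereProd_apply_fst_coe, homeomorphUnitSphereProd_apply_snd_coe,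
          PiLp.smul_apply, norm_smul, norm_inv, norm_norm]
        rw [← mul_assoc, ← mul_pow]
        congr 2
        field_simp
    _ = _ := by
        rw [hd, integral_prod_mul (fun ψ : PureState n ↦ ‖ψ.1 b‖ ^ (2 * ℓ))
          (fun r : Set.Ioi (0 : ℝ) ↦ r.1 ^ (2 * ℓ) * Real.exp (-r.1 ^ 2)), radial]

/-- Gaussian moments of one coordinate, up to a constant independent of the exponent. -/
theorem integral_gaussian_cartesian {n : ℕ} (b : Basis n) :
    ∃ C : ℝ, ∀ ℓ : ℕ, ∫ z : QubitSpace n, ‖z b‖ ^ (2 * ℓ) * Real.exp (-‖z‖ ^ 2) =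
      C * ℓ.factorial := by
  let L : (Basis n → ℂ) ≃L[ℝ] QubitSpace n :=
    (PiLp.continuousLinearEquiv 2 ℝ (fun _ : Basis n ↦ ℂ)).symm
  let ν : Measure (QubitSpace n) := Measure.map L volume
  have hν : ν.IsAddHaarMeasure := ContinuousLinearEquiv.isAddHaarMeasure_map L volume
  -- The volume and the pushed-forward product measure are both Haar, hence proportional. The factor
  -- `κ` need not be computed: it cancels against the case `ℓ = 0`.
  have hvol := Measure.isAddLeftInvariant_eq_smul (volume : Measure (QubitSpace n)) ν
  set κ := Measure.addHaarScalarFactor (volume : Measure (QubitSpace n)) ν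
  refine ⟨κ * Real.pi ^ Fintype.card (Basis n), fun ℓ ↦ ?_⟩
  have one (m : ℕ) : ∫ w : ℂ, ‖w‖ ^ (2 * m) * Real.exp (-‖w‖ ^ 2) = Real.pi * m.factorial := by
    have h := Complex.integral_rpow_mul_exp_neg_rpow (p := 2) (q := (2 * m : ℕ)) one_le_two
      (by have : (0 : ℝ) ≤ (2 * m : ℕ) := Nat.cast_nonneg _
          linarith)
    have hq : (((2 * m : ℕ) : ℝ) + 2) / 2 = m + 1 := by push_cast; ring
    rw [hq, Real.Gamma_nat_eq_factorial] at h
    simp only [Real.rpow_natCast, Real.rpow_ofNat] at h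
    rw [h]
    ring
  rw [hvol, integral_smul_nnreal_measure, NNReal.smul_def, smul_eq_mul, mul_assoc,
    show ∫ z, ‖z b‖ ^ (2 * ℓ) * Real.exp (-‖z‖ ^ 2) ∂ν =
      ∫ z : Basis n → ℂ, ‖L z b‖ ^ (2 * ℓ) * Real.exp (-‖L z‖ ^ 2) from
        L.toHomeomorph.measurableEmbedding.integral_map _]
  congr 1
  have expand (z : Basis n → ℂ) : ‖L z b‖ ^ (2 * ℓ) * Real.exp (-‖L z‖ ^ 2) =
      ∏ x, ‖z x‖ ^ (2 * if x = b then ℓ else 0) * Real.exp (-‖z x‖ ^ 2) := by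
    rw [Finset.prod_mul_distrib, ← Real.exp_sum, EuclideanSpace.norm_sq_eq, Finset.sum_neg_distrib]
    congr 1
    simp [mul_ite, pow_ite, Finset.prod_ite_eq', L]
  simp only [expand]
  rw [integral_fintype_prod_volume_eq_prod
    (fun x (w : ℂ) ↦ ‖w‖ ^ (2 * if x = b then ℓ else 0) * Real.exp (-‖w‖ ^ 2))]
  simp only [one]
  rw [Finset.prod_mul_distrib, Finset.prod_const]
  congr 1
  simp [apply_ite Nat.factorial, Finset.prod_ite_eq']

/-- Moments of one coordinate of a Haar random state. -/
theorem integral_norm_coord_pow {n : ℕ} (b : Basis n) (ℓ : ℕ) :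
    ∫ ψ : PureState n, ‖ψ.1 b‖ ^ (2 * ℓ) ∂haarState n = ((2 ^ n).multichoose ℓ : ℝ)⁻¹ := by
  obtain ⟨C, hC⟩ := integral_gaussian_cartesian b
  -- Dividing the identity for `ℓ` by the one for 0 eliminates `C`: the moment is `ℓ! Γ(2^n) / Γ(2^n
  -- + ℓ)`.
  have h0 := (integral_gaussian_polar b 0).symm.trans (hC 0)
  have hl := (integral_gaussian_polar b ℓ).symm.trans (hC ℓ)
  set S := (volume : Measure (QubitSpace n)).toSphere
  have hS : S.real Set.univ ≠ 0 := by
    rw [measureReal_ne_zero_iff]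
    rw [Ne, Measure.measure_univ_eq_zero]
    exact Measure.toSphere_ne_zero _
  simp only [mul_zero, pow_zero, integral_const, smul_eq_mul, mul_one, Nat.factorial_zero,
    Nat.cast_one, CharP.cast_eq_zero, zero_add] at h0
  obtain ⟨d, hd⟩ : ∃ d, 2 ^ n = d + 1 := ⟨2 ^ n - 1, (Nat.sub_add_cancel Nat.one_le_two_pow).symm⟩
  have hdR : (2 : ℝ) ^ n = d + 1 := by exact_mod_cast hd
  rw [hdR, Real.Gamma_nat_eq_factorial] at h0
  rw [hdR, ← add_assoc, ← Nat.cast_add, Real.Gamma_nat_eq_factorial] at hl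
  rw [haarState, integral_smul_measure, ENNReal.toReal_inv, smul_eq_mul, hd, Nat.multichoose_eq]
  change (S.real Set.univ)⁻¹ * _ = _
  have hch : ((d + 1 + ℓ - 1).choose ℓ : ℝ) * (ℓ.factorial * d.factorial) = (ℓ + d).factorial := by
    have := Nat.add_choose_mul_factorial_mul_factorial d ℓ
    rw [show d + 1 + ℓ - 1 = d + ℓ by omega, add_comm ℓ d, ← this]
    push_cast
    ring
  have hc0 : ((d + 1 + ℓ - 1).choose ℓ : ℝ) ≠ 0 := by
    exact_mod_cast (Nat.choose_pos (by omega)).ne'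
  have hf : ((ℓ.factorial : ℝ) * d.factorial) ≠ 0 := by positivity
  rw [← hch, ← h0] at hl
  field_simp
  have : (∫ ψ : PureState n, ‖ψ.1 b‖ ^ (2 * ℓ) ∂S) * ((d + 1 + ℓ - 1).choose ℓ : ℝ) *
      (ℓ.factorial * d.factorial) = S.real Set.univ * (ℓ.factorial * d.factorial) := by
    linear_combination 2 * hl
  have := mul_right_cancel₀ hf this
  linarith

end CHS

/-! ### The moment operator of a single Haar state. -/

namespace CHS

open MeasureTheory

/-- The diagonal unitary that multiplies the coordinate `a` by a phase `c`. -/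
noncomputable def coordPhase {n : ℕ} (a : Basis n) (c : ℂ) (hc : ‖c‖ = 1) :
    QubitSpace n ≃ₗᵢ[ℂ] QubitSpace n :=
  LinearIsometryEquiv.piLpCongrRight 2 fun x ↦
    if x = a then
      { LinearEquiv.smulOfNeZero ℂ ℂ c (norm_ne_zero_iff.mp (hc ▸ one_ne_zero)) with
        norm_map' := fun w ↦ by
          change ‖c • w‖ = ‖w‖
          rw [norm_smul, hc, one_mul] }
    else LinearIsometryEquiv.refl ℂ ℂ

theorem coordPhase_apply {n : ℕ} (a : Basis n) (c : ℂ) (hc : ‖c‖ = 1) (z : QubitSpace n)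
    (x : Basis n) : coordPhase a c hc z x = (if x = a then c else 1) * z x := by
  rw [coordPhase, LinearIsometryEquiv.piLpCongrRight_apply]
  change (if x = a then _ else _ : ℂ ≃ₗᵢ[ℂ] ℂ) (z x) = _
  split_ifs with h
  · rfl
  · simp

theorem integral_mapState {n : ℕ} (U : QubitSpace n ≃ₗᵢ[ℂ] QubitSpace n) (f : PureState n → ℂ)
    (hf : Continuous f) :
    ∫ ψ, f (mapState U ψ) ∂haarState n = ∫ ψ, f ψ ∂haarState n := by
  have h := measurePreserving_mapState U
  conv_rhs => rw [← h.map_eq]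
  rw [integral_map h.measurable.aemeasurable hf.aestronglyMeasurable]

theorem continuous_coord {n : ℕ} (x : Basis n) : Continuous fun ψ : PureState n ↦ ψ.1 x :=
  (EuclideanSpace.proj x : QubitSpace n →L[ℂ] ℂ).continuous.comp continuous_subtype_val

/-- Monomials that are unbalanced under phase changes have vanishing integral. -/
theorem integral_prod_coord_mul_star_pow_eq_zero {n : ℕ} {κ : Type*} [Fintype κ] (b : Basis n)
    (y : κ → Basis n) (hy : ∃ j, y j ≠ b) :
    ∫ ψ : PureState n, (∏ j, ψ.1 (y j)) * star (ψ.1 b) ^ Fintype.card κ ∂haarState n = 0 := by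
  obtain ⟨j₀, hj₀⟩ := hy
  set a := y j₀ with ha
  set m := (Finset.univ.filter fun j ↦ y j = a).card with hm
  have hm0 : m ≠ 0 := (Finset.card_pos.mpr ⟨j₀, by simp [ha]⟩).ne'
  -- The coordinate `a` occurs `m` times in the product and, as `a ≠ b`, not in the conjugated
  -- factor. A phase with `c ^ m = -1` on it thus negates the integrand.
  set c : ℂ := Complex.exp ((Real.pi / m : ℝ) * Complex.I)
  have hc : ‖c‖ = 1 := Complex.norm_exp_ofReal_mul_I _
  have hcm : c ^ m = -1 := by
    rw [← Complex.exp_nat_mul, ← Complex.exp_pi_mul_I]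
    congr 1
    push_cast
    field_simp
  have hcont : Continuous fun ψ : PureState n ↦
      (∏ j, ψ.1 (y j)) * star (ψ.1 b) ^ Fintype.card κ :=
    (continuous_finsetProd _ fun j _ ↦ continuous_coord (y j)).mul
      ((continuous_coord b).star.pow _)
  have h := integral_mapState (coordPhase a c hc) _ hcont
  have h2 (ψ : PureState n) : (∏ j, (mapState (coordPhase a c hc) ψ).1 (y j)) *
      star ((mapState (coordPhase a c hc) ψ).1 b) ^ Fintype.card κ =
      -((∏ j, ψ.1 (y j)) * star (ψ.1 b) ^ Fintype.card κ) := by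
    simp only [mapState, coordPhase_apply, if_neg (Ne.symm hj₀), one_mul, Finset.prod_mul_distrib]
    rw [Finset.prod_ite, Finset.prod_const_one, mul_one, Finset.prod_const, ← hm, hcm]
    ring
  simp only [h2, integral_neg] at h
  exact self_eq_neg.mp h.symm

/-- Every pure state is the image of a basis state under a unitary. -/
theorem exists_unitary_apply_single {n : ℕ} (b : Basis n) (ψ : PureState n) :
    ∃ U : QubitSpace n ≃ₗᵢ[ℂ] QubitSpace n, U (EuclideanSpace.single b 1) = ψ.1 := by
  have hψ : ‖ψ.1‖ = 1 := by simp
  have hon : Orthonormal ℂ (({b} : Set (Basis n)).domRestrict fun _ ↦ ψ.1) := by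
    refine ⟨fun i ↦ hψ, fun i j hij ↦ absurd (Subsingleton.elim i j) hij⟩
  obtain ⟨u, hu⟩ := hon.exists_orthonormalBasis_extension_of_card_eq (by simp)
  refine ⟨u.repr.symm, ?_⟩
  rw [← hu b rfl, OrthonormalBasis.repr_symm_single]

/-- Tensor powers of pure states are eigenvectors of the Haar moment operator. -/
theorem integral_prod_coord_mul_inner_pow {n : ℕ} {κ : Type*} [Fintype κ] (ψ : PureState n)
    (x : κ → Basis n) :
    ∫ φ : PureState n, (∏ j, φ.1 (x j)) * (∑ b, star (φ.1 b) * ψ.1 b) ^ Fintype.card κ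
      ∂haarState n = ((2 ^ n).multichoose (Fintype.card κ) : ℂ)⁻¹ * ∏ j, ψ.1 (x j) := by
  classical
  let b₀ : Basis n := fun _ ↦ false
  obtain ⟨U, hU⟩ := exists_unitary_apply_single b₀ ψ
  let u (y : Basis n) : QubitSpace n := U (EuclideanSpace.single y 1)
  have hcont : Continuous fun φ : PureState n ↦
      (∏ j, φ.1 (x j)) * (∑ b, star (φ.1 b) * ψ.1 b) ^ Fintype.card κ :=
    (continuous_finsetProd _ fun j _ ↦ continuous_coord (x j)).mul
      ((continuous_finsetSum _ fun b _ ↦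
        (continuous_coord b).star.mul continuous_const).pow _)
  -- Rotating `ψ` to a basis vector turns the overlap into the conjugate of one coordinate. After
  -- expansion only the monomial with all indices `b₀` survives.
  rw [← integral_mapState U _ hcont]
  have hinner (φ : PureState n) : ∑ b, star ((mapState U φ).1 b) * ψ.1 b = star (φ.1 b₀) := by
    have h1 : ∑ b, star ((mapState U φ).1 b) * ψ.1 b = inner ℂ (U φ.1) ψ.1 := by
      simp [PiLp.inner_apply, mapState, mul_comm]
    rw [h1, ← hU, U.inner_map_map, EuclideanSpace.inner_single_right]
    simp
  have hcoord (φ : PureState n) (z : Basis n) : (mapState U φ).1 z = ∑ y, φ.1 y * u y z := by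
    have h1 : φ.1 = ∑ y, φ.1 y • EuclideanSpace.single y (1 : ℂ) := by
      ext z
      simp [Pi.single_apply]
    have h2 : U φ.1 = ∑ y, φ.1 y • u y := by
      conv_lhs => rw [h1]
      simp [map_sum, u]
    simp [mapState, h2]
  have hint (y : κ → Basis n) : Integrable (fun φ : PureState n ↦
      (∏ j, φ.1 (y j)) * star (φ.1 b₀) ^ Fintype.card κ) (haarState n) :=
    integrable_of_continuous ((continuous_finsetProd _ fun j _ ↦ continuous_coord (y j)).mul
      ((continuous_coord b₀).star.pow _))
  have hexp (φ : PureState n) : (∏ j, (mapState U φ).1 (x j)) *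
      (∑ b, star ((mapState U φ).1 b) * ψ.1 b) ^ Fintype.card κ =
      ∑ y : κ → Basis n, (∏ j, u (y j) (x j)) *
        ((∏ j, φ.1 (y j)) * star (φ.1 b₀) ^ Fintype.card κ) := by
    rw [hinner]
    simp only [hcoord]
    rw [Finset.prod_univ_sum, Fintype.piFinset_univ, Finset.sum_mul]
    refine Finset.sum_congr rfl fun y _ ↦ ?_
    rw [Finset.prod_mul_distrib]
    ring
  simp only [hexp]
  rw [integral_finsetSum _ fun y _ ↦ (hint y).const_mul _]
  simp only [integral_const_mul]
  rw [Finset.sum_eq_single fun _ ↦ b₀]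
  · have h3 : ∫ φ : PureState n, (∏ _j : κ, φ.1 b₀) * star (φ.1 b₀) ^ Fintype.card κ
        ∂haarState n = ((2 ^ n).multichoose (Fintype.card κ) : ℂ)⁻¹ := by
      have h4 (φ : PureState n) : (∏ _j : κ, φ.1 b₀) * star (φ.1 b₀) ^ Fintype.card κ =
          ((‖φ.1 b₀‖ ^ (2 * Fintype.card κ) : ℝ) : ℂ) := by
        rw [Finset.prod_const, Finset.card_univ, ← mul_pow, pow_mul]
        simp [Complex.mul_conj']
      simp only [h4]
      rw [integral_complex_ofReal, integral_norm_coord_pow]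
      push_cast
      rfl
    rw [h3, mul_comm]
    simp [u, hU]
  · intro y _ hy
    rw [integral_prod_coord_mul_star_pow_eq_zero, mul_zero]
    by_contra! h
    exact hy (funext h)
  · simp

end CHS

/-! ### Several independent Haar states and the ideal acceptance probability. -/

namespace CHS

open MeasureTheory Matrix

/-- The coordinates of the product vector `⨂ r, ψ r`. -/
noncomputable def prodVec {ι : Type} [Fintype ι] {n : ℕ} (ψ : ι → PureState n) :
    (ι → Basis n) → ℂ :=
  fun x ↦ ∏ r, (ψ r).1 (x r)

theorem tensor_ketbra {ι : Type} [Fintype ι] {n : ℕ} (ψ : ι → PureState n) :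
    tensor (fun r ↦ ketbra (ψ r)) = vecMulVec (prodVec ψ) (star (prodVec ψ)) := by
  ext x y
  simp [tensor, ketbra, vecMulVec_apply, prodVec, Finset.prod_mul_distrib]

/-- The vector `⨂ i, ψ_i^{⊗ ℓ}`, on registers without copies of the common state. -/
noncomputable def powVec {n p : ℕ} (ℓ : ℕ) (ψ : Fin p → PureState n) :
    (Registers p ℓ 0 → Basis n) → ℂ :=
  prodVec (Sum.elim (fun r : Fin p × Fin ℓ ↦ ψ r.1) Fin.elim0)

theorem powVec_apply {n p ℓ : ℕ} (ψ : Fin p → PureState n) (x : Registers p ℓ 0 → Basis n) :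
    powVec ℓ ψ x = ∏ i, ∏ j : Fin ℓ, (ψ i).1 (x (Sum.inl (i, j))) := by
  simp [powVec, prodVec, Fintype.prod_sum_type, Fintype.prod_prod_type]

theorem jointState_ketbra_zero {n p ℓ : ℕ} (ψ : Fin p → PureState n)
    (τ : Matrix (Basis n) (Basis n) ℂ) :
    jointState ℓ 0 (fun i ↦ ketbra (ψ i)) τ =
      vecMulVec (powVec ℓ ψ) (star (powVec ℓ ψ)) := by
  rw [powVec, ← tensor_ketbra, jointState]
  congr 1
  ext r : 1
  rcases r with r | r
  · rfl
  · exact r.elim0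

theorem continuous_powVec {n p ℓ : ℕ} (x : Registers p ℓ 0 → Basis n) :
    Continuous fun ψ : Fin p → PureState n ↦ powVec ℓ ψ x := by
  simp only [powVec_apply]
  exact continuous_finsetProd _ fun i _ ↦ continuous_finsetProd _ fun j _ ↦
    (continuous_coord _).comp (continuous_apply i)

/-- Overlap of two product vectors. -/
theorem sum_star_powVec_mul_powVec {n p ℓ : ℕ} (φ ψ : Fin p → PureState n) :
    ∑ y, star (powVec ℓ φ y) * powVec ℓ ψ y =
      ∏ i, (∑ b, star ((φ i).1 b) * (ψ i).1 b) ^ ℓ := by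
  simp only [powVec, prodVec, star_prod, ← Finset.prod_mul_distrib]
  rw [← Fintype.piFinset_univ, ← Finset.prod_univ_sum (fun _ ↦ Finset.univ)
    (fun (r : Registers p ℓ 0) (b : Basis n) ↦
      star ((Sum.elim (fun r : Fin p × Fin ℓ ↦ φ r.1) Fin.elim0 r).1 b) *
        (Sum.elim (fun r : Fin p × Fin ℓ ↦ ψ r.1) Fin.elim0 r).1 b)]
  simp [Fintype.prod_sum_type, Fintype.prod_prod_type]

/-- The joint distribution of `p` independent Haar random states. -/
noncomputable abbrev haarPi (n p : ℕ) : Measure (Fin p → PureState n) :=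
  Measure.pi fun _ ↦ haarState n

theorem integrable_haarPi_of_continuous {n p : ℕ} {f : (Fin p → PureState n) → ℂ}
    (hf : Continuous f) : Integrable f (haarPi n p) := by
  have : CompactSpace (PureState n) := isCompact_iff_compactSpace.mp (isCompact_sphere _ _)
  exact hf.integrable_of_hasCompactSupport (HasCompactSupport.of_compactSpace f)

/-- The density matrix of `ℓ` copies of each of `p` independent Haar random states. -/
noncomputable def haarMoment (n p ℓ : ℕ) :
    Matrix (Registers p ℓ 0 → Basis n) (Registers p ℓ 0 → Basis n) ℂ :=
  Matrix.of fun x y ↦ ∫ ψ, powVec ℓ ψ x * star (powVec ℓ ψ y) ∂haarPi n p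

theorem isHermitian_haarMoment (n p ℓ : ℕ) : (haarMoment n p ℓ).IsHermitian := by
  ext x y
  simp only [haarMoment, conjTranspose_apply, of_apply]
  rw [← starRingEnd_apply, ← integral_conj]
  simp [mul_comm]

/-- Product vectors are eigenvectors of the moment operator. -/
theorem integral_powVec_mul_overlap {n p ℓ : ℕ} (ψ : Fin p → PureState n)
    (x : Registers p ℓ 0 → Basis n) :
    ∫ φ, powVec ℓ φ x * ∑ y, star (powVec ℓ φ y) * powVec ℓ ψ y ∂haarPi n p =
      ((2 ^ n).multichoose ℓ : ℂ)⁻¹ ^ p * powVec ℓ ψ x := by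
  simp only [sum_star_powVec_mul_powVec]
  simp only [powVec_apply, ← Finset.prod_mul_distrib]
  rw [integral_fintype_prod_eq_prod (fun i (φ : PureState n) ↦
    (∏ j : Fin ℓ, φ.1 (x (Sum.inl (i, j)))) * (∑ b, star (φ.1 b) * (ψ i).1 b) ^ ℓ)]
  have h (i : Fin p) := integral_prod_coord_mul_inner_pow (ψ i) fun j : Fin ℓ ↦ x (Sum.inl (i, j))
  simp only [Fintype.card_fin] at h
  simp only [h, Finset.prod_mul_distrib, Finset.prod_const, Finset.card_univ, Fintype.card_fin]

/-- The right factor is an average of projectors onto product vectors, and each such vector is an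
eigenvector of the left factor with the same eigenvalue. So the operator is a multiple of a
projection, with no need to identify its range. -/
theorem haarMoment_mul_self (n p ℓ : ℕ) :
    haarMoment n p ℓ * haarMoment n p ℓ =
      ((2 ^ n).multichoose ℓ : ℂ)⁻¹ ^ p • haarMoment n p ℓ := by
  ext x z
  rw [mul_apply, Matrix.smul_apply, smul_eq_mul]
  have hi (x y : Registers p ℓ 0 → Basis n) : Integrable
      (fun ψ : Fin p → PureState n ↦ powVec ℓ ψ x * star (powVec ℓ ψ y)) (haarPi n p) :=
    integrable_haarPi_of_continuous ((continuous_powVec x).mul (continuous_powVec y).star)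
  have h1 (ψ : Fin p → PureState n) : ∑ y, haarMoment n p ℓ x y *
      (powVec ℓ ψ y * star (powVec ℓ ψ z)) =
      ((2 ^ n).multichoose ℓ : ℂ)⁻¹ ^ p * (powVec ℓ ψ x * star (powVec ℓ ψ z)) := by
    simp only [← mul_assoc, ← integral_powVec_mul_overlap ψ x, ← Finset.sum_mul]
    congr 1
    simp only [Finset.mul_sum, ← mul_assoc]
    rw [integral_finsetSum _ fun y _ ↦ (hi x y).mul_const _]
    simp only [integral_mul_const, haarMoment, of_apply]
  calc ∑ y, haarMoment n p ℓ x y * haarMoment n p ℓ y z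
      = ∑ y, ∫ ψ, haarMoment n p ℓ x y * (powVec ℓ ψ y * star (powVec ℓ ψ z)) ∂haarPi n p := by
        simp only [integral_const_mul]
        rfl
    _ = ∫ ψ, ((2 ^ n).multichoose ℓ : ℂ)⁻¹ ^ p * (powVec ℓ ψ x * star (powVec ℓ ψ z))
          ∂haarPi n p := by
        rw [← integral_finsetSum _ fun y _ ↦ (hi y z).const_mul _]
        simp only [h1]
    _ = _ := by rw [integral_const_mul]; rfl

/-- A positive operator has at most its trace times the largest eigenvalue as expectation. -/
theorem trace_mul_re_le_of_mul_self {B : Type*} [Fintype B] [DecidableEq B]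
    {E σ : Matrix B B ℂ} (hE : E.PosSemidef) (hσ : σ.IsHermitian) {c : ℝ} (hc : 0 < c)
    (h : σ * σ = (c : ℂ) • σ) : (E * σ).trace.re ≤ c * E.trace.re := by
  -- `T` is Hermitian with `T² = cT`, so `c · Tr(TE) = Tr(T E Tᴴ) ≥ 0`.
  set T : Matrix B B ℂ := (c : ℂ) • 1 - σ with hT
  have hTh : Tᴴ = T := by
    rw [hT, conjTranspose_sub, conjTranspose_smul, conjTranspose_one, hσ.eq]
    simp
  have hTT : T * T = (c : ℂ) • T := by
    rw [hT, sub_mul, mul_sub, mul_sub, h]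
    simp [smul_sub]
  have h0 : 0 ≤ (T * E * Tᴴ).trace := (hE.mul_mul_conjTranspose_same T).trace_nonneg
  rw [hTh, trace_mul_comm, ← Matrix.mul_assoc, hTT, smul_mul_assoc, trace_smul, hT, sub_mul,
    trace_sub, smul_mul_assoc, one_mul, trace_smul, trace_mul_comm σ] at h0
  have h1 := (Complex.le_def.mp h0).1
  simp only [smul_eq_mul, Complex.zero_re, Complex.re_ofReal_mul, Complex.sub_re] at h1
  have := nonneg_of_mul_nonneg_right h1 hc
  linarith

/-- An adversary accepts independent Haar random states with probability bounded by its trace. -/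
theorem idealProb_zero_le {n p ℓ : ℕ} (A : Adversary (Registers p ℓ 0 → Basis n)) :
    idealProb n p ℓ 0 A ≤ ((2 ^ n).multichoose ℓ : ℝ)⁻¹ ^ p * A.effect.trace.re := by
  have hpos : 0 < (((2 ^ n).multichoose ℓ : ℕ) : ℝ) := by
    rw [Nat.multichoose_eq]
    exact_mod_cast Nat.choose_pos (by have := Nat.one_le_two_pow (n := n); omega)
  have key : idealProb n p ℓ 0 A = (A.effect * haarMoment n p ℓ).trace.re := by
    have hi (x y : Registers p ℓ 0 → Basis n) : Integrable
        (fun ψ : Fin p → PureState n ↦ A.effect x y * (powVec ℓ ψ y * star (powVec ℓ ψ x)))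
        (haarPi n p) :=
      (integrable_haarPi_of_continuous
        ((continuous_powVec y).mul (continuous_powVec x).star)).const_mul _
    have htr (ψ : Fin p → PureState n) :
        (A.effect * vecMulVec (powVec ℓ ψ) (star (powVec ℓ ψ))).trace =
          ∑ x, ∑ y, A.effect x y * (powVec ℓ ψ y * star (powVec ℓ ψ x)) := by
      simp [trace, mul_apply, vecMulVec_apply]
    simp only [idealProb, jointState_ketbra_zero, Adversary.acceptProb, htr]
    rw [integral_fun_fst (fun ψ : Fin p → PureState n ↦
      (∑ x, ∑ y, A.effect x y * (powVec ℓ ψ y * star (powVec ℓ ψ x))).re)]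
    simp only [probReal_univ, one_smul]
    rw [← RCLike.re_eq_complex_re, integral_re (integrable_finsetSum _ fun x _ ↦
      integrable_finsetSum _ fun y _ ↦ hi x y),
      integral_finsetSum _ fun x _ ↦ integrable_finsetSum _ fun y _ ↦ hi x y]
    simp only [fun x ↦ integral_finsetSum _ fun y (_ : y ∈ Finset.univ) ↦ hi x y,
      integral_const_mul]
    simp [trace, mul_apply, haarMoment]
  rw [key]
  refine trace_mul_re_le_of_mul_self A.effect_nonneg (isHermitian_haarMoment n p ℓ)
    (by positivity) ?_
  rw [haarMoment_mul_self]
  push_cast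
  rfl

end CHS

/-! ### Kraus operators and channels with pure outputs. -/

namespace CHS

open MeasureTheory Matrix

/-- A rank-one decomposition of a rank-one projection consists of parallel vectors. -/
theorem eq_inner_smul_of_sum_norm_inner_sq {E γ : Type*} [NormedAddCommGroup E]
    [InnerProductSpace ℂ E] [Fintype γ] {v : γ → E} {ψ : E} (hψ : ‖ψ‖ = 1)
    (h : ∀ w, ∑ c, ‖inner ℂ w (v c)‖ ^ 2 = ‖inner ℂ w ψ‖ ^ 2) (c : γ) :
    v c = inner ℂ ψ (v c) • ψ := by
  -- Testing the hypothesis on the component of `v c` orthogonal to `ψ` forces that component to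
  -- vanish.
  set w := v c - inner ℂ ψ (v c) • ψ with hw
  have hwψ : inner ℂ w ψ = 0 := by
    rw [hw, inner_sub_left, inner_smul_left, inner_self_eq_norm_sq_to_K, hψ, inner_conj_symm]
    simp
  have hsum := h w
  rw [hwψ, norm_zero, zero_pow two_ne_zero,
    Finset.sum_eq_zero_iff_of_nonneg fun _ _ ↦ sq_nonneg _] at hsum
  have hwv : inner ℂ w (v c) = 0 := by simpa using hsum c (Finset.mem_univ c)
  have hww : inner ℂ w w = 0 := by
    conv_lhs => rw [hw, inner_sub_right, ← hw, inner_smul_right, hwv, hwψ]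
    simp
  exact sub_eq_zero.mp (inner_self_eq_zero.mp hww)

open scoped MatrixOrder in
/-- Kraus decomposition of a quantum channel. -/
theorem QuantumChannel.exists_kraus {n m : ℕ} (Φ : QuantumChannel n m) :
    ∃ (γ : Type) (_ : Fintype γ) (K : γ → Matrix (Basis m) (Basis n) ℂ),
      ∀ M, Φ.toLinearMap M = ∑ c, K c * M * (K c)ᴴ := by
  let e := (Fintype.equivFin (Basis n)).symm
  -- The unnormalised maximally entangled vector: the ampliation of its projector is the Choi
  -- matrix, and the rows of a factor `B` with `Bᴴ B` equal to it give the Kraus operators.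
  let w : Fin (Fintype.card (Basis n)) × Basis n → ℂ := fun q ↦ if e q.1 = q.2 then 1 else 0
  have hJ := Φ.completelyPositive _ _ (posSemidef_vecMulVec_self_star w)
  obtain ⟨B, hB⟩ := CStarAlgebra.nonneg_iff_eq_star_mul_self.mp hJ.nonneg
  refine ⟨_, inferInstance, fun c ↦ of fun a x ↦ star (B c (e.symm x, a)), fun M ↦ ?_⟩
  have hblock (x y : Basis n) : Φ.toLinearMap (Matrix.single x y 1) = of fun a b ↦
      ∑ c, star (B c (e.symm x, a)) * B c (e.symm y, b) := by
    ext a b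
    have h := congr_fun (congr_fun hB (e.symm x, a)) (e.symm y, b)
    simp only [ampliation, of_apply, star_eq_conjTranspose, mul_apply,
      conjTranspose_apply] at h
    rw [of_apply, ← h]
    refine congr_fun (congr_fun (congrArg Φ.toLinearMap ?_) a) b
    ext p q
    simp [w, vecMulVec_apply, Matrix.single_apply, ← ite_and, eq_comm, and_comm]
  conv_lhs => rw [matrix_eq_sum_single M]
  have hs (x y : Basis n) : Matrix.single x y (M x y) = M x y • Matrix.single x y (1 : ℂ) := by
    rw [smul_single, smul_eq_mul, mul_one]
  simp only [map_sum, hs, map_smul, hblock]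
  ext a b
  simp only [Matrix.sum_apply, Matrix.smul_apply, of_apply, smul_eq_mul, mul_apply, conjTranspose_apply,
    star_star, Finset.sum_mul, Finset.mul_sum]
  rw [Finset.sum_comm]
  conv_rhs => rw [Finset.sum_comm]
  refine Finset.sum_congr rfl fun y _ ↦ ?_
  conv_rhs => rw [Finset.sum_comm]
  exact Finset.sum_congr rfl fun x _ ↦ Finset.sum_congr rfl fun c _ ↦ by ring

theorem sum_star_mul_self_eq_one {n : ℕ} (ψ : PureState n) :
    ∑ b, star (ψ.1 b) * ψ.1 b = 1 := by
  have h : inner ℂ ψ.1 ψ.1 = 1 := by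
    rw [inner_self_eq_norm_sq_to_K]
    simp
  rw [← h, PiLp.inner_apply]
  exact Finset.sum_congr rfl fun b _ ↦ mul_comm _ _

instance (n : ℕ) : Nonempty (PureState n) :=
  ⟨⟨EuclideanSpace.single (fun _ ↦ false) 1, by simp⟩⟩

/-- On generic pure states with pure images, a channel acts like a single nonzero operator. -/
theorem QuantumChannel.exists_operator_of_pure {n m : ℕ} (Φ : QuantumChannel n m) :
    ∃ K : Matrix (Basis m) (Basis n) ℂ, K ≠ 0 ∧ ∀ (ϑ : PureState n) (ψ : PureState m),
      Φ.toLinearMap (ketbra ϑ) = ketbra ψ → K *ᵥ ϑ.1 ≠ 0 →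
        ∃ s : ℂ, ∀ x, ψ.1 x = s * (K *ᵥ ϑ.1) x := by
  obtain ⟨γ, _, K, hK⟩ := Φ.exists_kraus
  -- Any nonzero Kraus operator serves: when the output is pure, every `K c ϑ` is a multiple of it.
  -- Trace preservation excludes that all vanish.
  obtain ⟨c, hc⟩ : ∃ c, K c ≠ 0 := by
    by_contra! h0
    obtain ⟨ϑ⟩ := (inferInstance : Nonempty (PureState n))
    have htr := Φ.tracePreserving (ketbra ϑ)
    have h1 : (ketbra ϑ).trace = 1 := by
      rw [← sum_star_mul_self_eq_one ϑ]
      simp [ketbra, trace, mul_comm]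
    rw [hK, h1] at htr
    simp [h0] at htr
  refine ⟨K c, hc, fun ϑ ψ hψ hne ↦ ?_⟩
  let v (c : γ) : QubitSpace m := WithLp.toLp 2 (K c *ᵥ ϑ.1)
  have hentry (a b : Basis m) : ∑ c, v c a * star (v c b) = ψ.1 a * star (ψ.1 b) := by
    have h1 := congr_fun (congr_fun (hK (ketbra ϑ)) a) b
    have h2 : ketbra ϑ = vecMulVec ϑ.1 (star ϑ.1) := by
      ext x y
      simp [ketbra, vecMulVec_apply]
    rw [hψ, h2, Matrix.sum_apply] at h1
    simp only [mul_vecMulVec, vecMulVec_mul, ← star_mulVec] at h1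
    simpa [ketbra, vecMulVec_apply, v] using h1.symm
  have hsq (w : QubitSpace m) : ∑ c, ‖inner ℂ w (v c)‖ ^ 2 = ‖inner ℂ w ψ.1‖ ^ 2 := by
    have hn (u : QubitSpace m) : ((‖inner ℂ w u‖ ^ 2 : ℝ) : ℂ) =
        ∑ a, ∑ b, star (w a) * w b * (u a * star (u b)) := by
      push_cast
      rw [← Complex.mul_conj', PiLp.inner_apply, map_sum, Finset.sum_mul_sum]
      refine Finset.sum_congr rfl fun a _ ↦ Finset.sum_congr rfl fun b _ ↦ ?_
      simp
      ring
    apply Complex.ofReal_injective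
    rw [Complex.ofReal_sum, hn]
    simp only [hn, ← hentry, Finset.mul_sum]
    rw [Finset.sum_comm]
    exact Finset.sum_congr rfl fun a _ ↦ Finset.sum_comm
  have hpar := eq_inner_smul_of_sum_norm_inner_sq (by simp) hsq c
  have hs : inner ℂ ψ.1 (v c) ≠ 0 := by
    intro h0
    rw [h0, zero_smul] at hpar
    exact hne (congrArg WithLp.ofLp hpar)
  refine ⟨(inner ℂ ψ.1 (v c))⁻¹, fun x ↦ ?_⟩
  change _ = _ * v c x
  conv_rhs => rw [hpar]
  simp [hs]

end CHS

/-! ### The distinguishing measurement. -/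

namespace CHS

open MeasureTheory Matrix

/-- The matrix of the orthogonal projection onto a subspace. -/
theorem exists_projection_matrix {B : Type*} [Fintype B] [DecidableEq B]
    (W : Submodule ℂ (EuclideanSpace ℂ B)) :
    ∃ E : Matrix B B ℂ, E.PosSemidef ∧ (1 - E).PosSemidef ∧
      E.trace = (Module.finrank ℂ W : ℂ) ∧ ∀ v ∈ W, E *ᵥ v.ofLp = v.ofLp := by
  let b := stdOrthonormalBasis ℂ W
  have hdot (i j) : star (b i).1.ofLp ⬝ᵥ (b j).1.ofLp = if i = j then 1 else 0 := by
    rw [← orthonormal_iff_ite.mp b.orthonormal i j, Submodule.coe_inner,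
      EuclideanSpace.inner_eq_star_dotProduct, dotProduct_comm]
  let E : Matrix B B ℂ := ∑ i, vecMulVec (b i).1.ofLp (star (b i).1.ofLp)
  have hE : E.PosSemidef := posSemidef_sum _ fun i _ ↦ posSemidef_vecMulVec_self_star _
  have hEE : E * E = E := by
    simp only [E, Finset.sum_mul_sum, vecMulVec_mul_vecMulVec, hdot, ite_smul, one_smul, zero_smul,
      apply_ite (vecMulVec _), vecMulVec_zero, Finset.sum_ite_eq, Finset.mem_univ, if_true]
  refine ⟨E, hE, ?_, ?_, fun v hv ↦ ?_⟩
  · have h : (1 - E) = (1 - E)ᴴ * (1 - E) := by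
      rw [conjTranspose_sub, conjTranspose_one, hE.1.eq, sub_mul, mul_sub, mul_sub, hEE]
      simp
    rw [h]
    exact posSemidef_conjTranspose_mul_self _
  · simp only [E, trace_sum, trace_vecMulVec]
    simp [dotProduct_comm _ (star _), hdot]
  · have hv' := congrArg (fun u : W ↦ u.1.ofLp) (b.sum_repr ⟨v, hv⟩)
    simp only [E, sum_mulVec, vecMulVec_mulVec]
    conv_rhs => rw [← hv']
    simp only [AddSubmonoidClass.coe_finsetSum, WithLp.ofLp_sum]
    refine Finset.sum_congr rfl fun i _ ↦ ?_
    rw [b.repr_apply_apply, Submodule.coe_inner, EuclideanSpace.inner_eq_star_dotProduct,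
      dotProduct_comm]
    ext x
    simp [mul_comm]

theorem Adversary.acceptProb_eq_one {B : Type} [Fintype B] [DecidableEq B] (A : Adversary B)
    {v : B → ℂ} (hv : A.effect *ᵥ v = v) (h1 : ∑ y, star (v y) * v y = 1) :
    A.acceptProb (vecMulVec v (star v)) = 1 := by
  rw [Adversary.acceptProb, mul_vecMulVec, hv, trace_vecMulVec, dotProduct_comm]
  change (∑ y, star (v y) * v y).re = 1
  rw [h1, Complex.one_re]

/-- The multiset of values of a function on a finite type. -/
def valueSym {ι α : Type} [Fintype ι] (y : ι → α) : Sym α (Fintype.card ι) :=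
  Sym.mk (Finset.univ.val.map y) (by simp)

/-- For finitely many families `K k r` of operators, the product vectors `⨂ r, K k r ϑ` lie in a
subspace whose dimension is at most the number of families times the dimension of the symmetric
subspace. -/
theorem exists_submodule_prod_mulVec {n m : ℕ} {κ ι : Type} [Fintype κ] [DecidableEq κ]
    [Fintype ι] (K : κ → ι → Matrix (Basis m) (Basis n) ℂ) :
    ∃ W : Submodule ℂ (EuclideanSpace ℂ (ι → Basis m)),
      Module.finrank ℂ W ≤ Fintype.card κ * (2 ^ n).multichoose (Fintype.card ι) ∧
      ∀ (k : κ) (z : Basis n → ℂ), WithLp.toLp 2 (fun x : ι → Basis m ↦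
        ∏ r, (K k r *ᵥ z) (x r)) ∈ W := by
  classical
  -- The coefficient `∏ r, z (y r)` depends only on the multiset of values of `y`. Hence the product
  -- vectors factor through a space indexed by a family and a multiset.
  let L : (κ × Sym (Basis n) (Fintype.card ι) → ℂ) →ₗ[ℂ] EuclideanSpace ℂ (ι → Basis m) :=
    (WithLp.linearEquiv 2 ℂ _).symm.toLinearMap ∘ₗ
      (Matrix.of fun (x : ι → Basis m) (q : κ × Sym (Basis n) (Fintype.card ι)) ↦
        ∑ y : ι → Basis n, if valueSym y = q.2 then ∏ r, K q.1 r (x r) (y r) else 0).mulVecLin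
  refine ⟨LinearMap.range L, ?_, fun k z ↦ ?_⟩
  · refine (LinearMap.finrank_range_le L).trans ?_
    rw [Module.finrank_fintype_fun_eq_card, Fintype.card_prod, Sym.card_sym_eq_multichoose]
    simp
  · refine ⟨fun q ↦ if q.1 = k then (q.2.1.map z).prod else 0, ?_⟩
    ext x
    change ∑ q : κ × Sym (Basis n) (Fintype.card ι),
      (∑ y : ι → Basis n, if valueSym y = q.2 then ∏ r, K q.1 r (x r) (y r) else 0) *
        (if q.1 = k then (q.2.1.map z).prod else 0) = ∏ r, ∑ b, K k r (x r) b * z b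
    rw [Finset.prod_univ_sum, Fintype.piFinset_univ, Fintype.sum_prod_type, Finset.sum_comm]
    simp only [mul_ite, mul_zero, Finset.sum_ite_eq', Finset.mem_univ, if_true, Finset.sum_mul,
      ite_mul, zero_mul]
    rw [Finset.sum_comm]
    refine Finset.sum_congr rfl fun y _ ↦ ?_
    simp only [Finset.sum_ite_eq, Finset.mem_univ, if_true, Finset.prod_mul_distrib]
    congr 1
    change ((Finset.univ.val.map y).map z).prod = _
    rw [Multiset.map_map]
    rfl

/-- Generators in the common Haar state model are recognised with certainty by a measurement of
small trace. -/
theorem exists_adversary_of_stateGeneration {n : ℕ → ℕ} {G : OneCopyGenerator n}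
    (hG : StateGeneration G) (lam p ℓ : ℕ) :
    ∃ A : Adversary (Registers p ℓ 0 → Basis (n lam)), realProb G lam p ℓ 0 A = 1 ∧
      A.effect.trace.re ≤ ((2 ^ lam) ^ p : ℝ) * ((2 ^ n lam).multichoose (p * ℓ) : ℝ) := by
  choose K hK0 hK using fun k ↦ (G lam k).exists_operator_of_pure
  obtain ⟨W, hWdim, hW⟩ := exists_submodule_prod_mulVec
    (fun (k : Fin p → Fin lam → Bool) (r : Registers p ℓ 0) ↦
      K (Sum.elim (fun r : Fin p × Fin ℓ ↦ k r.1) Fin.elim0 r))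
  obtain ⟨E, hE0, hE1, htr, hEW⟩ := exists_projection_matrix W
  refine ⟨⟨E, hE0, hE1⟩, ?_, ?_⟩
  · have hone (k : Fin p → Fin lam → Bool) : ∫ ϑ : PureState (n lam),
        Adversary.acceptProb ⟨E, hE0, hE1⟩ (jointState ℓ 0
          (fun i ↦ (G lam (k i)).toLinearMap (ketbra ϑ)) (ketbra ϑ)) ∂haarState (n lam) = 1 := by
      -- The kernels of the finitely many nonzero operators are proper subspaces, hence null.
      have hae : ∀ᵐ ϑ ∂haarState (n lam), ∀ i, K (k i) *ᵥ ϑ.1 ≠ 0 := by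
        rw [ae_all_iff]
        intro i
        let W₀ := LinearMap.ker ((K (k i)).mulVecLin ∘ₗ (WithLp.linearEquiv 2 ℂ _).toLinearMap)
        refine ae_notMem_submodule W₀ fun htop ↦ hK0 (k i) ?_
        rw [LinearMap.ker_eq_top] at htop
        ext a b
        have h := congr_fun (LinearMap.congr_fun htop (EuclideanSpace.single b 1)) a
        simpa using h
      refine (integral_congr_ae (g := fun _ ↦ 1) ?_).trans (by simp)
      filter_upwards [hae] with ϑ hϑ
      choose ψ hψ using fun i ↦ hG lam (k i) ϑ
      choose s hs using fun i ↦ hK (k i) ϑ (ψ i) (hψ i) (hϑ i)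
      simp only [hψ]
      rw [jointState_ketbra_zero]
      refine Adversary.acceptProb_eq_one _ ?_ ?_
      · have hmem : WithLp.toLp 2 (powVec ℓ ψ) ∈ W := by
          have hv : WithLp.toLp 2 (powVec ℓ ψ) = (∏ i, ∏ _j : Fin ℓ, s i) •
              WithLp.toLp 2 (fun x : Registers p ℓ 0 → Basis (n lam) ↦ ∏ r,
                (K (Sum.elim (fun r : Fin p × Fin ℓ ↦ k r.1) Fin.elim0 r) *ᵥ ϑ.1) (x r)) := by
            ext x
            simp [powVec_apply, hs, Fintype.prod_sum_type, Fintype.prod_prod_type,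
              Finset.prod_mul_distrib]
          rw [hv]
          exact W.smul_mem _ (hW k _)
        exact hEW _ hmem
      · rw [sum_star_powVec_mul_powVec]
        simp only [sum_star_mul_self_eq_one, one_pow, Finset.prod_const_one]
    rw [realProb]
    simp only [hone]
    simp
  · rw [htr, Complex.natCast_re]
    calc (Module.finrank ℂ W : ℝ) ≤ _ := Nat.cast_le.mpr hWdim
      _ = _ := by simp

end CHS

/-! ### Dimension estimates and the choice of the number of keys. -/

namespace CHS

open Filter

theorem multichoose_pos {d : ℕ} (hd : 0 < d) (m : ℕ) : (0 : ℝ) < d.multichoose m := by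
  rw [Nat.multichoose_eq]
  exact_mod_cast Nat.choose_pos (by omega)

theorem multichoose_succ {d : ℕ} (hd : 0 < d) (m : ℕ) :
    (d.multichoose (m + 1) : ℝ) = (d + m) / (m + 1) * d.multichoose m := by
  have h := Nat.add_one_mul_choose_eq (d + m - 1) m
  rw [show d + m - 1 + 1 = d + m by omega] at h
  rw [Nat.multichoose_eq, Nat.multichoose_eq, show d + (m + 1) - 1 = d + m by omega,
    div_mul_eq_mul_div, eq_div_iff (by positivity)]
  exact_mod_cast h.symm

/-- The left side is the product of `d + j` over `j < m`, and each factor is at most `2d` since `m ≤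
d`. -/
theorem multichoose_mul_factorial_le {d m : ℕ} (hd : 0 < d) (hm : m ≤ d) :
    (d.multichoose m : ℝ) * m.factorial ≤ (2 * d) ^ m := by
  induction m with
  | zero => simp
  | succ m ih =>
    have hm' : (m : ℝ) ≤ d := by exact_mod_cast (Nat.le_succ m).trans hm
    rw [multichoose_succ hd, Nat.factorial_succ, pow_succ]
    push_cast
    calc ((d : ℝ) + m) / (m + 1) * d.multichoose m * ((m + 1) * m.factorial)
        = (d.multichoose m * m.factorial) * (d + m) := by field_simp
      _ ≤ (2 * d) ^ m * (2 * d) := by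
        gcongr
        · exact ih (by omega)
        · linarith

theorem pow_le_multichoose_mul_factorial {d : ℕ} (hd : 0 < d) (m : ℕ) :
    (d : ℝ) ^ m ≤ (d.multichoose m : ℝ) * m.factorial := by
  induction m with
  | zero => simp
  | succ m ih =>
    rw [multichoose_succ hd, Nat.factorial_succ, pow_succ]
    push_cast
    calc (d : ℝ) ^ m * d ≤ (d.multichoose m * m.factorial) * (d + m) := by
          gcongr
          linarith [(Nat.cast_nonneg m : (0 : ℝ) ≤ m)]
      _ = ((d : ℝ) + m) / (m + 1) * d.multichoose m * ((m + 1) * m.factorial) := by field_simp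

/-- Passing from `N` to `N + 1` multiplies by `(d + N) / (N + 1)`, which is nonincreasing in `N` as
`d ≥ 1`; here `N ≥ ℓ`. -/
theorem multichoose_add_le {d p : ℕ} (hd : 0 < d) (hp : 0 < p) (ℓ j : ℕ) :
    (d.multichoose (p * ℓ + j) : ℝ) ≤
      (((d : ℝ) + ℓ) / (ℓ + 1)) ^ j * d.multichoose (p * ℓ) := by
  induction j with
  | zero => simp
  | succ j ih =>
    have h1 : (1 : ℝ) ≤ d := by exact_mod_cast hd
    have h2 : (ℓ : ℝ) ≤ ((p * ℓ + j : ℕ) : ℝ) := by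
      exact_mod_cast (Nat.le_mul_of_pos_left ℓ hp).trans (Nat.le_add_right _ _)
    rw [← add_assoc, multichoose_succ hd, pow_succ', mul_assoc]
    refine mul_le_mul ?_ ih (Nat.cast_nonneg _) (by positivity)
    rw [div_le_div_iff₀ (by positivity) (by positivity)]
    nlinarith

/-- The ratio between the dimension of the symmetric subspace of `p * ℓ` systems and that of `p`
symmetric subspaces of `ℓ` systems decreases with `ℓ`. -/
theorem antitone_multichoose_ratio {d p : ℕ} (hd : 0 < d) (hp : 0 < p) :
    Antitone fun ℓ : ℕ ↦ ((d.multichoose ℓ : ℝ)⁻¹) ^ p * d.multichoose (p * ℓ) := by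
  refine antitone_nat_of_succ_le fun ℓ ↦ ?_
  have h0 := multichoose_pos hd ℓ
  have hc : 0 < ((d : ℝ) + ℓ) / (ℓ + 1) := by positivity
  rw [multichoose_succ hd, mul_add_one, mul_inv, mul_pow]
  calc _ ≤ (((d : ℝ) + ℓ) / (ℓ + 1))⁻¹ ^ p * (d.multichoose ℓ : ℝ)⁻¹ ^ p *
        ((((d : ℝ) + ℓ) / (ℓ + 1)) ^ p * d.multichoose (p * ℓ)) := by
        gcongr
        exact multichoose_add_le hd hp ℓ p
    _ = _ := by
        rw [inv_pow]
        field_simp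

/-- `m ^ m / m!` is one term of the series of `e ^ m`, and `e < 3`. -/
theorem pow_self_le_factorial (m : ℕ) : (m : ℝ) ^ m ≤ 3 ^ m * m.factorial := by
  have h := Real.pow_div_factorial_le_exp (m : ℝ) (Nat.cast_nonneg m) m
  rw [div_le_iff₀ (by positivity), ← mul_one (m : ℝ), Real.exp_nat_mul, mul_one] at h
  refine h.trans ?_
  gcongr
  exact Real.exp_one_lt_three.le

/-- Monotonicity replaces `ℓ`, which may be huge compared with `d`, by a small `m`. In `6 = 2 · 3`
the 2 comes from `d + j ≤ 2d` and the 3 from `(pm)! ≥ (pm/3)^{pm}`. -/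
theorem multichoose_ratio_le {d p ℓ m : ℕ} (hd : 0 < d) (hp : 0 < p) (hm : m ≤ ℓ)
    (hmd : p * m ≤ d) :
    ((d.multichoose ℓ : ℝ)⁻¹) ^ p * d.multichoose (p * ℓ) ≤ ((6 / p : ℝ) ^ m) ^ p := by
  refine (antitone_multichoose_ratio hd hp hm).trans ?_
  have h0 := multichoose_pos hd m
  have hd' : (0 : ℝ) < d := by exact_mod_cast hd
  have hp' : (0 : ℝ) < p := by exact_mod_cast hp
  have h1 := multichoose_mul_factorial_le hd hmd
  have h2 : (d.multichoose m : ℝ)⁻¹ ≤ m.factorial / d ^ m := by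
    rw [inv_le_comm₀ h0 (by positivity), inv_div, div_le_iff₀ (by positivity)]
    exact pow_le_multichoose_mul_factorial hd m
  have h3 : (m.factorial : ℝ) ≤ m ^ m := by exact_mod_cast Nat.factorial_le_pow m
  have h4 := pow_self_le_factorial (p * m)
  have hf : (0 : ℝ) < (p * m).factorial := by positivity
  calc ((d.multichoose m : ℝ)⁻¹) ^ p * d.multichoose (p * m)
      ≤ (m.factorial / d ^ m : ℝ) ^ p * ((2 * d) ^ (p * m) / (p * m).factorial) := by
        gcongr
        rwa [le_div_iff₀ hf]
    _ ≤ (m ^ m / d ^ m : ℝ) ^ p * ((2 * d) ^ (p * m) / (p * m).factorial) := by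
        gcongr
    _ = (2 : ℝ) ^ (p * m) * (m : ℝ) ^ (p * m) / (p * m).factorial := by
        rw [div_pow, ← pow_mul, ← pow_mul, mul_comm m p, mul_pow]
        field_simp
    _ ≤ (6 / p : ℝ) ^ (p * m) := by
        rw [div_le_iff₀ hf, div_pow, div_mul_eq_mul_div, le_div_iff₀ (by positivity)]
        calc (2 : ℝ) ^ (p * m) * (m : ℝ) ^ (p * m) * p ^ (p * m)
            = 2 ^ (p * m) * ((p * m : ℕ) : ℝ) ^ (p * m) := by
              push_cast
              rw [mul_pow (p : ℝ)]
              ring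
          _ ≤ 2 ^ (p * m) * (3 ^ (p * m) * (p * m).factorial) := by gcongr
          _ = 6 ^ (p * m) * (p * m).factorial := by
              rw [← mul_assoc, ← mul_pow]
              norm_num
    _ = _ := by rw [mul_comm p m, pow_mul]

/-- For polynomially many keys the measurement that recognises the generator has small rank
compared with the ideal state. -/
theorem exists_eventually_key_count_mul_ratio_le {n ℓ : ℕ → ℕ}
    (hℓ : (fun lam : ℕ => (lam : ℝ) / Real.log (lam : ℝ)) =O[atTop] (fun lam : ℕ => (ℓ lam : ℝ)))
    (hn : (fun lam : ℕ => Real.log (lam : ℝ)) =o[atTop] (fun lam : ℕ => (n lam : ℝ))) :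
    ∃ k : ℕ, ∀ᶠ lam in atTop,
      ((2 ^ n lam).multichoose (ℓ lam) : ℝ)⁻¹ ^ (lam ^ k) *
        ((2 ^ lam) ^ (lam ^ k) * ((2 ^ n lam).multichoose (lam ^ k * ℓ lam) : ℝ)) ≤ 1 / 2 := by
  obtain ⟨C, hC, hCℓ⟩ := hℓ.exists_pos
  obtain ⟨k, hk⟩ := exists_nat_ge (2 * max C 1)
  -- This constant yields `lam ^ (k + 2) ≤ 2 ^ n lam`, which covers `p * m` for `p = lam ^ (k + 1)`
  -- and `m ≤ lam`.
  have hc0 : (0 : ℝ) < Real.log 2 / (k + 2) := div_pos (Real.log_pos one_lt_two) (by positivity)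
  refine ⟨k + 1, ?_⟩
  filter_upwards [hCℓ.bound, hn.bound hc0, eventually_ge_atTop 6] with lam h1 h2 h6
  have h6' : (6 : ℝ) ≤ lam := by exact_mod_cast h6
  have hlam : (0 : ℝ) < lam := by linarith
  have hlog1 : 1 ≤ Real.log lam := by
    rw [Real.le_log_iff_exp_le hlam]
    linarith [Real.exp_one_lt_three]
  have hlog : 0 < Real.log lam := by linarith
  set c := max C 1
  have hc1 : 1 ≤ c := le_max_right _ _
  have hcpos : 0 < c := by linarith
  -- Small enough for `m ≤ ℓ lam`, yet `m * k * log lam ≥ 2 * lam` because `k ≥ 2c`. Taking `c ≥ 1`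
  -- also gives `m ≤ lam`.
  set m := ⌈(lam : ℝ) / (c * Real.log lam)⌉₊ with hm
  have hmℓ : m ≤ ℓ lam := by
    rw [hm, Nat.ceil_le, ← div_div, div_right_comm, div_le_iff₀ hcpos]
    rw [Real.norm_of_nonneg (by positivity), Real.norm_of_nonneg (Nat.cast_nonneg _)] at h1
    calc _ ≤ C * (ℓ lam : ℝ) := h1
      _ ≤ c * ℓ lam := by gcongr; exact le_max_left _ _
      _ = _ := mul_comm _ _
  have hmlam : m ≤ lam := by
    rw [hm, Nat.ceil_le]
    exact div_le_self hlam.le (by nlinarith)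
  have hd : 0 < 2 ^ n lam := by positivity
  have hp : 0 < lam ^ (k + 1) := by positivity
  have hmd : lam ^ (k + 1) * m ≤ 2 ^ n lam := by
    refine (Nat.mul_le_mul_left _ hmlam).trans ?_
    rw [← pow_succ, ← Nat.cast_le (α := ℝ)]
    push_cast
    rw [← Real.log_le_log_iff (by positivity) (by positivity), Real.log_pow, Real.log_pow]
    rw [Real.norm_of_nonneg hlog.le, Real.norm_of_nonneg (Nat.cast_nonneg _),
      div_mul_eq_mul_div, le_div_iff₀ (by positivity)] at h2
    push_cast
    linarith
  have hratio := multichoose_ratio_le hd hp hmℓ hmd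
  -- The extra factor `lam` in `lam ^ (k + 1)` absorbs the 6.
  have hsix : (6 / (lam ^ (k + 1) : ℕ) : ℝ) ≤ Real.exp (-(k * Real.log lam)) := by
    rw [Real.exp_neg, Real.exp_nat_mul, Real.exp_log hlam, div_le_iff₀ (by positivity)]
    push_cast
    rw [pow_succ, inv_mul_cancel_left₀ (by positivity)]
    exact h6'
  have hbase : (2 : ℝ) ^ lam * (6 / (lam ^ (k + 1) : ℕ) : ℝ) ^ m ≤ 1 / 2 := by
    have hexp : (2 * lam : ℝ) ≤ m * (k * Real.log lam) := by
      have h7 : (lam : ℝ) / (c * Real.log lam) ≤ m := Nat.le_ceil _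
      rw [div_le_iff₀ (by positivity)] at h7
      calc (2 * lam : ℝ) ≤ 2 * (m * (c * Real.log lam)) := by linarith
        _ = m * ((2 * c) * Real.log lam) := by ring
        _ ≤ _ := by gcongr
    have h2e : (2 : ℝ) ≤ Real.exp 1 := by
      have := Real.add_one_le_exp (1 : ℝ)
      linarith
    calc (2 : ℝ) ^ lam * (6 / (lam ^ (k + 1) : ℕ) : ℝ) ^ m
        ≤ Real.exp 1 ^ lam * Real.exp (-(k * Real.log lam)) ^ m := by gcongr
      _ = Real.exp (lam - m * (k * Real.log lam)) := by
        rw [← Real.exp_nat_mul, ← Real.exp_nat_mul, ← Real.exp_add]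
        congr 1
        ring
      _ ≤ Real.exp (-1) := Real.exp_le_exp.mpr (by linarith)
      _ ≤ 1 / 2 := by
        rw [Real.exp_neg, one_div]
        gcongr
  calc _ = (2 ^ lam : ℝ) ^ (lam ^ (k + 1)) * (((2 ^ n lam).multichoose (ℓ lam) : ℝ)⁻¹ ^
        (lam ^ (k + 1)) * ((2 ^ n lam).multichoose (lam ^ (k + 1) * ℓ lam) : ℝ)) := by ring
    _ ≤ (2 ^ lam : ℝ) ^ (lam ^ (k + 1)) *
        ((6 / (lam ^ (k + 1) : ℕ) : ℝ) ^ m) ^ (lam ^ (k + 1)) := by gcongr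
    _ = ((2 : ℝ) ^ lam * (6 / (lam ^ (k + 1) : ℕ) : ℝ) ^ m) ^ (lam ^ (k + 1)) := by
        rw [mul_pow]
    _ ≤ (2 : ℝ) ^ lam * (6 / (lam ^ (k + 1) : ℕ) : ℝ) ^ m :=
        pow_le_of_le_one (by positivity) (by linarith) hp.ne'
    _ ≤ 1 / 2 := hbase

/-- The type of the adversary contains `t`, which the main proof takes to be `(0 : Polynomial
ℕ).eval lam`. Keeping `t` a variable with `ht` allows substitution instead of rewriting in that
type. -/
theorem exists_distinguishing_adversary {n : ℕ → ℕ} {G : OneCopyGenerator n}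
    (hG : StateGeneration G) (lam p ℓ t : ℕ) (ht : t = 0) :
    ∃ A : Adversary (Registers p ℓ t → Basis (n lam)), realProb G lam p ℓ t A = 1 ∧
      idealProb (n lam) p ℓ t A ≤ ((2 ^ n lam).multichoose ℓ : ℝ)⁻¹ ^ p *
        ((2 ^ lam) ^ p * ((2 ^ n lam).multichoose (p * ℓ) : ℝ)) := by
  subst ht
  obtain ⟨A, hA1, hA2⟩ := exists_adversary_of_stateGeneration hG lam p ℓ
  exact ⟨A, hA1, (idealProb_zero_le A).trans (by gcongr)⟩

end CHS

theorem mainTheorem3 (n ℓ : ℕ → ℕ)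
    (hℓ : (fun lam : ℕ => (lam : ℝ) / Real.log (lam : ℝ)) =O[Filter.atTop]
      (fun lam : ℕ => (ℓ lam : ℝ)))
    (hn : (fun lam : ℕ => Real.log (lam : ℝ)) =o[Filter.atTop] (fun lam : ℕ => (n lam : ℝ))) :
    ¬ ∃ G : CHS.OneCopyGenerator n, CHS.IsMultiKeyStatisticalPRS ℓ G := by
  rintro ⟨G, hG⟩
  obtain ⟨k, hk⟩ := CHS.exists_eventually_key_count_mul_ratio_le hℓ hn
  choose A hreal hideal using fun lam : ℕ ↦ CHS.exists_distinguishing_adversary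
    hG.stateGeneration lam ((Polynomial.X ^ k : Polynomial ℕ).eval lam) (ℓ lam)
    ((0 : Polynomial ℕ).eval lam) Polynomial.eval_zero
  obtain ⟨negl, hnegl, hle⟩ := hG.pseudorandom 0 (Polynomial.X ^ k) A
  -- Superpolynomial decay is used only with exponent 0: the advantage is at least 1/2 for all large
  -- `lam`.
  have hlim : Filter.Tendsto negl Filter.atTop (nhds 0) := by simpa using hnegl 0
  obtain ⟨lam, h1, h2⟩ := (hk.and (hlim.eventually_lt_const (by norm_num : (0 : ℝ) < 1 / 2))).exists
  have h3 := hideal lam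
  rw [← show (Polynomial.X ^ k : Polynomial ℕ).eval lam = lam ^ k by simp] at h1
  have h4 := hle lam
  rw [hreal lam] at h4
  have h5 := le_abs_self (1 - CHS.idealProb (n lam)
    ((Polynomial.X ^ k : Polynomial ℕ).eval lam) (ℓ lam) ((0 : Polynomial ℕ).eval lam) (A lam))
  linarith
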